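/- Let $l\ge 2$, $t\ge 0$ and $2t+1\le d_0\le n$ be fixed integers, write $h(\gamma)$ for the binary entropy function and $h(\mathbf z)=-\sum_i z_i\log_2 z_i$ for the entropy of a probability vector, and put $$\mathcal M(t,\gamma)=\Big\{\mathbf z=(z_0,\dots,z_n)\in[0,1]^{n+1}:\ \sum_{i=0}^n z_i=1,\ \sum_{i=1}^n i z_i=\gamma n,\ \sum_{i=1}^t i z_i=\sum_{i=d_0-t}^n t z_i\Big\},$$ $$\tilde F_{n,t}(\gamma)=\max_{\mathbf z\in\mathcal M(t,\gamma)}\Big(h(\mathbf z)+\sum_{i=0}^n z_i\log_2\binom ni\Big),$$ $$\gamma_0=\sup\Big\{x>0:\ \tfrac ln\tilde F_{n,t}(\gamma)<(l-1)h(\gamma)\ \text{ for all } 0<\gamma\le x\Big\}$$ ($\gamma_0=0$ if there is no such $x$). For $m\ge 1$ let $H$ be a random $l$-partite $n$-regular hypergraph with parts $V_1,\dots,V_l$ of size $m$ and a set $E$ of $N=nm$ hyperedges: each part has $N$ places, $n$ at each of its vertices; the hyperedges occupy the places of $V_1$ in order, and $l-1$ independent uniformly random permutations of $N$ elements assign them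 to the places of $V_2,\dots,V_l$. For a vertex $v$ let $E(v)$ be the set of hyperedges incident to $v$. For $\mathcal E\subset E$ let $G_i=\{v\in V_i:|E(v)\cap\mathcal E|\le t\}$, $B_i=\{v\in V_i:|E(v)\cap\mathcal E|\ge d_0-t\}$, and let $\mathcal E(G_i)$ be the set of elements of $\mathcal E$ incident to vertices of $G_i$. For a binary linear code $A$ of length $n$ with minimum distance $d_0$, let $C$ be the code of all $x\in\{0,1\}^E$ whose projection on the $n$ hyperedges at every vertex lies in $A$ (the hyperedges at a vertex being ordered by their places). The $i$-th subprocedure replaces, at every vertex $v\in V_i$, the projection of the current word by the unique codeword of $A$ at Hamming distance at most $t$ from it, if there is one, and leaves it unchanged otherwise. Algorithm II starts from the list consisting of the received word; each iteration replaces the list by the results of applying each of the $l$ subprocedures to each of its members. Then for all $0<\beta<\gamma<\gamma_0$ there are $\varepsilon>0$, $c>0$ and an integer $s$, independent of $m$, such that for all sufficiently large $m$, with probability at least $1-2^{-cN}$ the hypergraph $H$ has both of the following properties. 1. For every $\mathcal E\subset E$ with $\beta N\le|\mathcal E|\le\gamma N$ there is $i\in\{1,\dots,l\}$ such that $|\mathcal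 E(G_i)|\ge t|B_i|+\varepsilon N$. 2. For every such code $A$, every $x\in C$ and every received word $y$ at Hamming distance at most $\gamma N$ from $x$, after some number $j\le s$ of iterations the list of Algorithm II contains a word at Hamming distance at most $\beta N$ from $x$. -/

import Mathlib

noncomputable section

namespace HypergraphCodes

/-- Base-2 entropy `h(z) = -∑ zᵢ log₂ zᵢ` of a probability vector. -/
def entropy {k : ℕ} (z : Fin k → ℝ) : ℝ :=
  ∑ i, Real.negMulLog (z i) / Real.log 2

/-- Base-2 binary entropy `h(γ) = -γ log₂ γ - (1 - γ) log₂ (1 - γ)`. -/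
def binaryEntropy (γ : ℝ) : ℝ := Real.binEntropy γ / Real.log 2

/-- The region `M(t, γ)` of probability vectors `z = (z₀, …, zₙ)` with `∑ i zᵢ = γ n` and
`∑_{1 ≤ i ≤ t} i zᵢ = ∑_{d₀ - t ≤ i ≤ n} t zᵢ`. -/
def region (n t d₀ : ℕ) (γ : ℝ) : Set (Fin (n + 1) → ℝ) :=
  {z | z ∈ stdSimplex ℝ (Fin (n + 1)) ∧
    ∑ i : Fin (n + 1), ((i : ℕ) : ℝ) * z i = γ * n ∧
    ∑ i : Fin (n + 1), (if (i : ℕ) ≤ t then ((i : ℕ) : ℝ) * z i else 0) =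
      ∑ i : Fin (n + 1), (if d₀ - t ≤ (i : ℕ) then (t : ℝ) * z i else 0)}

/-- The objective `h(z) + ∑ zᵢ log₂ (n choose i)`. -/
def objective (n : ℕ) (z : Fin (n + 1) → ℝ) : ℝ :=
  entropy z + ∑ i : Fin (n + 1), z i * Real.logb 2 (n.choose i)

/-- `F̃_{n,t}(γ)`, the maximum of the objective over the compact region `M(t, γ)`. -/
def Ftilde (n t d₀ : ℕ) (γ : ℝ) : ℝ :=
  sSup (objective n '' region n t d₀ γ)

/-- `γ₀ = sup {x > 0 : (l/n) F̃_{n,t}(γ) < (l-1) h(γ) for all 0 < γ ≤ x}`. -/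
def gammaZero (l n t d₀ : ℕ) : ℝ :=
  sSup {x : ℝ | 0 < x ∧ ∀ γ : ℝ, 0 < γ → γ ≤ x →
    ((l : ℝ) / n) * Ftilde n t d₀ γ < ((l : ℝ) - 1) * binaryEntropy γ}

/-- The `N = n m` hyperedges; a hyperedge is named by the place `(v, s)` that it takes in the
first part: it is the `s`-th of the `n` hyperedges at the vertex `v`. -/
abbrev Edge (n m : ℕ) : Type := Fin m × Fin n

/-- An `l`-partite `n`-regular hypergraph with parts of size `m`, given by `l - 1` permutations
of the `N = n m` places; the `i`-th one places the edges in the part number `i + 1`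
(parts are numbered from `0`). -/
abbrev Hypergraph (l n m : ℕ) : Type := Fin (l - 1) → Equiv.Perm (Edge n m)

variable {l n m : ℕ}

/-- The place `(v, s)` that each edge takes in part `i`; in the first part it is the edge's
own name. -/
def place (H : Hypergraph l n m) (i : Fin l) : Equiv.Perm (Edge n m) :=
  if h : (i : ℕ) = 0 then Equiv.refl _ else H ⟨(i : ℕ) - 1, by omega⟩

/-- The vertex of the part `Vᵢ` that lies on the edge `e`. -/
def endpoint (H : Hypergraph l n m) (i : Fin l) (e : Edge n m) : Fin m := (place H i e).1

/-- `E(v)`, the set of edges incident to the vertex `v` of the part `Vᵢ`. -/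
def edgesAt (H : Hypergraph l n m) (i : Fin l) (v : Fin m) : Finset (Edge n m) :=
  {e | endpoint H i e = v}

/-- `Gᵢ`, the vertices of `Vᵢ` incident to at most `t` edges of the error set. -/
def goodVertices (t : ℕ) (H : Hypergraph l n m) (i : Fin l) (err : Finset (Edge n m)) :
    Finset (Fin m) :=
  {v | (edgesAt H i v ∩ err).card ≤ t}

/-- `Bᵢ`, the vertices of `Vᵢ` incident to at least `d₀ - t` edges of the error set. -/
def badVertices (t d₀ : ℕ) (H : Hypergraph l n m) (i : Fin l) (err : Finset (Edge n m)) :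
    Finset (Fin m) :=
  {v | d₀ - t ≤ (edgesAt H i v ∩ err).card}

/-- The edges of the error set that are incident to the vertices of `Gᵢ`. -/
def goodEdges (t : ℕ) (H : Hypergraph l n m) (i : Fin l) (err : Finset (Edge n m)) :
    Finset (Edge n m) :=
  {e ∈ err | endpoint H i e ∈ goodVertices t H i err}

/-- Probability of `P` when the `l - 1` permutations are independent and uniformly random. -/
def ensembleProb (l n m : ℕ) (P : Hypergraph l n m → Prop) : ℝ :=
  (Nat.card {H : Hypergraph l n m // P H} : ℝ) / (Nat.card (Hypergraph l n m) : ℝ)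

/-- `A` is a binary linear code of length `n` with minimum distance `d₀`. -/
def HasMinDist (A : Submodule (ZMod 2) (Fin n → ZMod 2)) (d₀ : ℕ) : Prop :=
  IsLeast {w : ℕ | ∃ a ∈ A, a ≠ 0 ∧ hammingNorm a = w} d₀

/-- The projection `x(v)` of `x` on the edges incident to the vertex `v` of the part `Vᵢ`. -/
def localWord (H : Hypergraph l n m) (i : Fin l) (x : Edge n m → ZMod 2) (v : Fin m) :
    Fin n → ZMod 2 :=
  fun s => x ((place H i).symm (v, s))

/-- The code of the hypergraph `H` with local code `A`. -/
def graphCode (A : Submodule (ZMod 2) (Fin n → ZMod 2)) (H : Hypergraph l n m) :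
    Set (Edge n m → ZMod 2) :=
  {x | ∀ (i : Fin l) (v : Fin m), localWord H i x v ∈ A}

open scoped Classical in
/-- The local decoder `ψ_{A,t}`: the unique codeword at distance at most `t`, if there is one,
and otherwise the word itself. -/
def localDecode (A : Submodule (ZMod 2) (Fin n → ZMod 2)) (t : ℕ) (z : Fin n → ZMod 2) :
    Fin n → ZMod 2 :=
  if h : ∃! a, a ∈ A ∧ hammingDist z a ≤ t then h.choose else z

/-- The `i`-th subprocedure: decode the local code at every vertex of the part `Vᵢ`. -/
def subprocedure (A : Submodule (ZMod 2) (Fin n → ZMod 2)) (t : ℕ) (H : Hypergraph l n m)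
    (i : Fin l) (u : Edge n m → ZMod 2) : Edge n m → ZMod 2 :=
  fun e => localDecode A t (localWord H i u (endpoint H i e)) (place H i e).2

/-- The list of candidates held by Algorithm II after `j` iterations on the received vector `y`:
each iteration applies each of the `l` subprocedures to each candidate. -/
def candidates (A : Submodule (ZMod 2) (Fin n → ZMod 2)) (t : ℕ) (H : Hypergraph l n m)
    (y : Edge n m → ZMod 2) : ℕ → Set (Edge n m → ZMod 2)
  | 0 => {y}
  | j + 1 => {z | ∃ u ∈ candidates A t H y j, ∃ i : Fin l, z = subprocedure A t H i u}

end HypergraphCodes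

end

/-!
The argument is a first moment bound over the error sets, followed by a deterministic count.

Call an error set bad if in every part it gives `|𝓔(Gᵢ)| < t |Bᵢ| + ε N`. In each part, the error
set is seen as a set of places, whose *type* `z` records the fraction of vertices with `k` errors,
for `k = 0, …, n`; the condition at that part says that `balance n t d₀ z < ε n`
(`balance_typeDist_map_place`). A permutation turns a fixed set of size `w` into a uniformly
random set of that size (`card_perm_map_mul_choose`), hence the expected number of bad sets of
size `w` is at most `B ^ l / C ^ (l - 1)`, where `C = N.choose w` and `B` counts the sets of size
`w` whose type satisfies the condition (`ensembleProb_exists_le`). There are polynomially many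
types, a type `z` is shared by at most `2 ^ (m objective z)` sets (`card_type_class_le`), and `C`
is `2 ^ (N h(w / N))` up to a polynomial factor (`exp_binEntropy_le`). So everything rests on
`(l / n) objective z < (l - 1) h(γ)`, uniformly over the types of mean `γ n` that satisfy the
condition.

The definition of `gammaZero` gives this inequality for types of balance exactly zero. It extends
to negative balance because the objective is concave and, for a given mean, maximal at the
binomial distribution, with value `n h(γ)`: if the binomial distribution has positive balance, a
type of nonpositive balance can be moved towards it until the balance vanishes, without decreasing
the objective (`logObjective_lt_of_balance_nonpos`). The binomial distribution does have positive
balance below the threshold: this holds for small `γ`, and by continuity a change of sign would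
produce a `γ` at which the binomial distribution is balanced, so that `F̃ = n h(γ)` and the strict
inequality fails (`exponent_neg_of_lt_gammaZero`). Compactness then yields uniform constants and
room for the slack `ε` (`exists_uniform_exponent`).

The second property follows from the first for every single hypergraph: the subprocedure of part
`i` corrects the errors at `Gᵢ`, adds at most `t` errors at each vertex of `Bᵢ` and leaves the
other vertices alone (`hammingDist_subprocedure_add_le`). Hence a suitable choice of the part
removes `ε N` errors at each iteration (`exists_candidate`).
-/

noncomputable section

namespace HypergraphCodes

/-! ### Entropy and the exponent of the bound -/

/-- The function that `objective` maximizes, in natural units: `objective` times `log 2`. -/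
def logObjective (n : ℕ) (z : Fin (n + 1) → ℝ) : ℝ :=
  ∑ i : Fin (n + 1), (Real.negMulLog (z i) + z i * Real.log (n.choose i))

/-- The mean `∑ i zᵢ` of a distribution on `{0, …, n}`. -/
def mean (n : ℕ) (z : Fin (n + 1) → ℝ) : ℝ := ∑ i : Fin (n + 1), ((i : ℕ) : ℝ) * z i

/-- `∑_{i ≤ t} i zᵢ - ∑_{i ≥ d₀ - t} t zᵢ`: the guaranteed decrease of the number of errors per
vertex when `z` is the distribution of the number of errors at a vertex. -/
def balance (n t d₀ : ℕ) (z : Fin (n + 1) → ℝ) : ℝ :=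
  ∑ i : Fin (n + 1), (if (i : ℕ) ≤ t then ((i : ℕ) : ℝ) * z i else 0) -
    ∑ i : Fin (n + 1), (if d₀ - t ≤ (i : ℕ) then (t : ℝ) * z i else 0)

/-- The binomial distribution with parameters `n` and `p`. -/
def binomial (n : ℕ) (p : ℝ) (i : Fin (n + 1)) : ℝ :=
  n.choose i * p ^ (i : ℕ) * (1 - p) ^ (n - (i : ℕ))

theorem objective_eq (n : ℕ) (z : Fin (n + 1) → ℝ) :
    objective n z = logObjective n z / Real.log 2 := by
  simp only [objective, entropy, logObjective, Real.logb, Finset.sum_add_distrib, add_div,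
    Finset.sum_div, mul_div_assoc]

theorem mem_region_iff {n t d₀ : ℕ} {γ : ℝ} {z : Fin (n + 1) → ℝ} :
    z ∈ region n t d₀ γ ↔
      z ∈ stdSimplex ℝ (Fin (n + 1)) ∧ mean n z = γ * n ∧ balance n t d₀ z = 0 := by
  simp only [region, mean, balance, sub_eq_zero, Set.mem_ofPred_eq]

theorem continuous_logObjective (n : ℕ) : Continuous (logObjective n) := by
  unfold logObjective
  have := Real.continuous_negMulLog
  fun_prop

theorem continuous_mean (n : ℕ) : Continuous (mean n) := by
  unfold mean
  fun_prop

theorem continuous_balance (n t d₀ : ℕ) : Continuous (balance n t d₀) := by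
  unfold balance
  refine Continuous.sub ?_ ?_ <;> refine continuous_finsetSum _ fun i _ => ?_ <;> split_ifs <;>
    fun_prop

theorem mean_combo (n : ℕ) (a b : ℝ) (z w : Fin (n + 1) → ℝ) :
    mean n (a • z + b • w) = a * mean n z + b * mean n w := by
  simp only [mean, Finset.mul_sum, ← Finset.sum_add_distrib]
  exact Finset.sum_congr rfl fun i _ => by simp; ring

theorem balance_combo (n t d₀ : ℕ) (a b : ℝ) (z w : Fin (n + 1) → ℝ) :
    balance n t d₀ (a • z + b • w) = a * balance n t d₀ z + b * balance n t d₀ w := by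
  simp only [balance, mul_sub, Finset.mul_sum]
  rw [sub_add_sub_comm]
  simp only [← Finset.sum_add_distrib]
  congr 1 <;> refine Finset.sum_congr rfl fun i _ => ?_ <;> split_ifs <;> simp <;> ring

theorem logObjective_combo_ge {n : ℕ} {a b : ℝ} {z w : Fin (n + 1) → ℝ} (ha : 0 ≤ a) (hb : 0 ≤ b)
    (hab : a + b = 1) (hz : ∀ i, 0 ≤ z i) (hw : ∀ i, 0 ≤ w i) :
    a * logObjective n z + b * logObjective n w ≤ logObjective n (a • z + b • w) := by
  simp only [logObjective, Finset.mul_sum, ← Finset.sum_add_distrib]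
  refine Finset.sum_le_sum fun i _ => ?_
  have := Real.concaveOn_negMulLog.2 (hz i) (hw i) ha hb hab
  simp only [smul_eq_mul] at this
  simp only [Pi.add_apply, Pi.smul_apply, smul_eq_mul]
  linarith

/-! ### The binomial distribution -/

theorem binomial_pos {n : ℕ} {p : ℝ} (h0 : 0 < p) (h1 : p < 1) (i : Fin (n + 1)) :
    0 < binomial n p i := by
  have : 0 < n.choose i := Nat.choose_pos (by omega)
  have : 0 < 1 - p := by linarith
  unfold binomial
  positivity

theorem eval_bernsteinPolynomial (n : ℕ) (p : ℝ) (i : Fin (n + 1)) :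
    (bernsteinPolynomial ℝ n i).eval p = binomial n p i := by
  simp [bernsteinPolynomial, binomial]

theorem sum_binomial (n : ℕ) (p : ℝ) : ∑ i, binomial n p i = 1 := by
  have := congrArg (Polynomial.eval p) (bernsteinPolynomial.sum ℝ n)
  rw [Polynomial.eval_finsetSum, Finset.sum_range] at this
  simpa [eval_bernsteinPolynomial] using this

theorem mean_binomial (n : ℕ) (p : ℝ) : mean n (binomial n p) = p * n := by
  have := congrArg (Polynomial.eval p) (bernsteinPolynomial.sum_smul ℝ n)
  rw [Polynomial.eval_finsetSum, Finset.sum_range] at this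
  simpa [eval_bernsteinPolynomial, mean, mul_comm p] using this

theorem binomial_mem_stdSimplex {n : ℕ} {p : ℝ} (h0 : 0 < p) (h1 : p < 1) :
    binomial n p ∈ stdSimplex ℝ (Fin (n + 1)) :=
  ⟨fun i => (binomial_pos h0 h1 i).le, sum_binomial n p⟩

/-- The objective exceeds `n` times the binary entropy of the mean by minus the divergence of `z`
from the binomial distribution with the same mean. -/
theorem logObjective_eq {n : ℕ} {p : ℝ} (h0 : 0 < p) (h1 : p < 1) {z : Fin (n + 1) → ℝ}
    (hz : z ∈ stdSimplex ℝ (Fin (n + 1))) (hm : mean n z = p * n) :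
    logObjective n z = n * Real.binEntropy p +
      ∑ i, (Real.negMulLog (z i) + z i * Real.log (binomial n p i)) := by
  have hq : 0 < 1 - p := by linarith
  have hlog (i : Fin (n + 1)) : z i * Real.log (binomial n p i) =
      z i * Real.log (n.choose i) + (Real.log p - Real.log (1 - p)) * ((i : ℕ) * z i) +
        n * Real.log (1 - p) * z i := by
    have hc : (0 : ℝ) < n.choose i := by exact_mod_cast Nat.choose_pos (by omega)
    have hi : (i : ℕ) ≤ n := by omega
    rw [binomial, Real.log_mul (by positivity) (by positivity),
      Real.log_mul (by positivity) (by positivity), Real.log_pow, Real.log_pow, Nat.cast_sub hi]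
    ring
  simp only [hlog, ← add_assoc]
  rw [Finset.sum_add_distrib, Finset.sum_add_distrib, ← Finset.mul_sum, ← Finset.mul_sum, hz.2,
    ← logObjective]
  change logObjective n z = _ + (_ + _ * mean n z + _)
  rw [hm, Real.binEntropy_eq_negMulLog_add_negMulLog_one_sub, Real.negMulLog, Real.negMulLog]
  ring

theorem logObjective_le {n : ℕ} {p : ℝ} (h0 : 0 < p) (h1 : p < 1) {z : Fin (n + 1) → ℝ}
    (hz : z ∈ stdSimplex ℝ (Fin (n + 1))) (hm : mean n z = p * n) :
    logObjective n z ≤ n * Real.binEntropy p := by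
  rw [logObjective_eq h0 h1 hz hm]
  have key (i : Fin (n + 1)) :
      Real.negMulLog (z i) + z i * Real.log (binomial n p i) ≤ binomial n p i - z i := by
    have hb := binomial_pos h0 h1 i
    rcases (hz.1 i).eq_or_lt with h | h
    · simp [← h, hb.le]
    · have := mul_le_mul_of_nonneg_left (Real.log_le_sub_one_of_pos (div_pos hb h)) h.le
      rw [Real.log_div hb.ne' h.ne', mul_sub, mul_sub, mul_div_cancel₀ _ h.ne'] at this
      rw [Real.negMulLog]
      linarith
  have := Finset.sum_le_sum fun i (_ : i ∈ Finset.univ) => key i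
  rw [Finset.sum_sub_distrib (f := binomial n p), sum_binomial, hz.2] at this
  linarith

theorem logObjective_binomial {n : ℕ} {p : ℝ} (h0 : 0 < p) (h1 : p < 1) :
    logObjective n (binomial n p) = n * Real.binEntropy p := by
  rw [logObjective_eq h0 h1 (binomial_mem_stdSimplex h0 h1) (mean_binomial n p)]
  simp [Real.negMulLog]

theorem continuous_balance_binomial (n t d₀ : ℕ) :
    Continuous fun p => balance n t d₀ (binomial n p) := by
  refine (continuous_balance n t d₀).comp (continuous_pi fun i => ?_)
  unfold binomial
  fun_prop

/-- For a small mean, vertices with a single error dominate, so that the balance of the binomial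
distribution is positive. -/
theorem exists_balance_binomial_pos {n t d₀ : ℕ} (ht : 1 ≤ t) (htd : 2 * t + 1 ≤ d₀)
    (hdn : d₀ ≤ n) {x : ℝ} (hx : 0 < x) :
    ∃ p, 0 < p ∧ p < x ∧ p < 1 ∧ 0 < balance n t d₀ (binomial n p) := by
  have hn : 0 < n := by omega
  have hcont : Continuous fun p : ℝ => n * (1 - p) ^ (n - 1) - t * p * 2 ^ n := by fun_prop
  have hpos : ∀ᶠ p : ℝ in nhdsWithin 0 (Set.Ioi 0),
      0 < n * (1 - p) ^ (n - 1) - t * p * 2 ^ n :=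
    (hcont.tendsto 0).eventually_const_lt (by simpa using hn) |>.filter_mono nhdsWithin_le_nhds
  have hlt : ∀ᶠ p : ℝ in nhdsWithin 0 (Set.Ioi 0), p ∈ Set.Ioo 0 (min x 1) :=
    Ioo_mem_nhdsGT (by positivity)
  obtain ⟨p, hp, h0, hpx⟩ := (hpos.and hlt).exists
  obtain ⟨hpx, hp1⟩ := lt_min_iff.1 hpx
  refine ⟨p, h0, hpx, hp1, ?_⟩
  have hfirst : n * p * (1 - p) ^ (n - 1) ≤
      ∑ i : Fin (n + 1), (if (i : ℕ) ≤ t then ((i : ℕ) : ℝ) * binomial n p i else 0) := by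
    refine le_trans ?_ (Finset.single_le_sum (fun i _ => ?_)
      (Finset.mem_univ (⟨1, by omega⟩ : Fin (n + 1))))
    · simp [ht, binomial]
    · have := binomial_pos h0 hp1 i
      positivity
  have hsecond : ∑ i : Fin (n + 1), (if d₀ - t ≤ (i : ℕ) then (t : ℝ) * binomial n p i else 0) ≤
      t * p ^ 2 * 2 ^ n := by
    have : (2 : ℝ) ^ n = ∑ i : Fin (n + 1), (n.choose i : ℝ) := by
      rw [← Finset.sum_range fun i => (n.choose i : ℝ)]
      exact_mod_cast (Nat.sum_range_choose n).symm
    rw [this, Finset.mul_sum]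
    refine Finset.sum_le_sum fun i _ => ?_
    split_ifs with h
    · rw [mul_assoc]
      refine mul_le_mul_of_nonneg_left ?_ (by positivity)
      have h2 : p ^ (i : ℕ) ≤ p ^ 2 := pow_le_pow_of_le_one h0.le hp1.le (by omega)
      have h3 : (1 - p) ^ (n - (i : ℕ)) ≤ 1 := pow_le_one₀ (by linarith) (by linarith)
      have h4 : (0 : ℝ) ≤ (1 - p) ^ (n - (i : ℕ)) := pow_nonneg (by linarith) _
      calc binomial n p i = n.choose i * (p ^ (i : ℕ) * (1 - p) ^ (n - (i : ℕ))) := by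
            rw [binomial]; ring
        _ ≤ n.choose i * (p ^ 2 * 1) := by gcongr
        _ = _ := by ring
    · positivity
  have := mul_pos h0 hp
  rw [balance]
  nlinarith

/-! ### The exponent is negative below the threshold -/

theorem bddAbove_objective {n t d₀ : ℕ} {p : ℝ} (h0 : 0 < p) (h1 : p < 1) :
    BddAbove (objective n '' region n t d₀ p) := by
  refine ⟨n * Real.binEntropy p / Real.log 2, ?_⟩
  rintro _ ⟨z, hz, rfl⟩
  rw [mem_region_iff] at hz
  rw [objective_eq]
  exact div_le_div_of_nonneg_right (logObjective_le h0 h1 hz.1 hz.2.1)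
    (Real.log_nonneg one_le_two)

theorem logObjective_lt_of_mem_region {l n t d₀ : ℕ} {p : ℝ} (h0 : 0 < p) (h1 : p < 1)
    (h : (l / n : ℝ) * Ftilde n t d₀ p < (l - 1) * binaryEntropy p) {z : Fin (n + 1) → ℝ}
    (hz : z ∈ region n t d₀ p) :
    (l / n : ℝ) * logObjective n z < (l - 1) * Real.binEntropy p := by
  have h2 : 0 < Real.log 2 := Real.log_pos one_lt_two
  have hle : objective n z ≤ Ftilde n t d₀ p :=
    le_csSup (bddAbove_objective h0 h1) (Set.mem_image_of_mem _ hz)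
  have := (mul_le_mul_of_nonneg_left hle (by positivity : (0 : ℝ) ≤ l / n)).trans_lt h
  rwa [objective_eq, binaryEntropy, ← mul_div_assoc, ← mul_div_assoc,
    div_lt_div_iff_of_pos_right h2] at this

theorem balance_binomial_ne_zero {l n t d₀ : ℕ} (hn : 0 < n) {p : ℝ} (h0 : 0 < p) (h1 : p < 1)
    (h : (l / n : ℝ) * Ftilde n t d₀ p < (l - 1) * binaryEntropy p) :
    balance n t d₀ (binomial n p) ≠ 0 := by
  intro hb
  have := logObjective_lt_of_mem_region h0 h1 h
    (mem_region_iff.2 ⟨binomial_mem_stdSimplex h0 h1, mean_binomial n p, hb⟩)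
  have hn' : (n : ℝ) ≠ 0 := by positivity
  rw [logObjective_binomial h0 h1, ← mul_assoc, div_mul_cancel₀ _ hn'] at this
  linarith [Real.binEntropy_pos h0 h1]

/-- If the binomial distribution has positive balance, then the bound over the distributions of
balance zero extends to those of nonpositive balance: on the segment from `z` to the binomial
distribution, which maximizes the concave objective for its mean, the point of balance zero has
at least the objective of `z`. -/
theorem logObjective_lt_of_balance_nonpos {l n t d₀ : ℕ} {p : ℝ} (h0 : 0 < p) (h1 : p < 1)
    (h : (l / n : ℝ) * Ftilde n t d₀ p < (l - 1) * binaryEntropy p)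
    (hb : 0 < balance n t d₀ (binomial n p)) {z : Fin (n + 1) → ℝ}
    (hz : z ∈ stdSimplex ℝ (Fin (n + 1))) (hm : mean n z = p * n) (hz0 : balance n t d₀ z ≤ 0) :
    (l / n : ℝ) * logObjective n z < (l - 1) * Real.binEntropy p := by
  have hbs := binomial_mem_stdSimplex (n := n) h0 h1
  have hd : 0 < balance n t d₀ (binomial n p) - balance n t d₀ z := by linarith
  set a := balance n t d₀ (binomial n p) / (balance n t d₀ (binomial n p) - balance n t d₀ z)
    with ha
  set b := -balance n t d₀ z / (balance n t d₀ (binomial n p) - balance n t d₀ z) with hb'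
  have ha0 : 0 ≤ a := by positivity
  have hb0 : 0 ≤ b := div_nonneg (by linarith) hd.le
  have hab : a + b = 1 := by rw [ha, hb', ← add_div, ← sub_eq_add_neg, div_self hd.ne']
  have hmem : a • z + b • binomial n p ∈ region n t d₀ p := by
    rw [mem_region_iff]
    refine ⟨convex_stdSimplex ℝ _ hz hbs ha0 hb0 hab, ?_, ?_⟩
    · rw [mean_combo, hm, mean_binomial, ← add_mul, hab, one_mul]
    · rw [balance_combo, ha, hb']
      ring
  refine lt_of_le_of_lt ?_ (logObjective_lt_of_mem_region h0 h1 h hmem)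
  refine mul_le_mul_of_nonneg_left ?_ (by positivity)
  have h3 := logObjective_combo_ge ha0 hb0 hab hz.1 hbs.1
  have h4 := logObjective_le h0 h1 hz hm
  rw [← logObjective_binomial h0 h1] at h4
  have h5 := mul_le_mul_of_nonneg_left h4 hb0
  calc logObjective n z = a * logObjective n z + b * logObjective n z := by
        rw [← add_mul, hab, one_mul]
    _ ≤ _ := by linarith

theorem exists_gt_of_lt_gammaZero {l n t d₀ : ℕ} {γ : ℝ} (h0 : 0 < γ)
    (hγ : γ < gammaZero l n t d₀) :
    ∃ x, γ < x ∧ ∀ p : ℝ, 0 < p → p ≤ x →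
      (l / n : ℝ) * Ftilde n t d₀ p < (l - 1) * binaryEntropy p := by
  rcases Set.eq_empty_or_nonempty {x : ℝ | 0 < x ∧ ∀ γ : ℝ, 0 < γ → γ ≤ x →
    ((l : ℝ) / n) * Ftilde n t d₀ γ < ((l : ℝ) - 1) * binaryEntropy γ} with he | hne
  · rw [gammaZero, he, Real.sSup_empty] at hγ
    exact absurd hγ h0.le.not_gt
  · obtain ⟨x, hx, hlt⟩ := exists_lt_of_lt_csSup hne hγ
    exact ⟨x, hlt, hx.2⟩

theorem lt_one_of_lt_gammaZero {l n t d₀ : ℕ} {γ : ℝ} (h0 : 0 < γ)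
    (hγ : γ < gammaZero l n t d₀) : γ < 1 := by
  obtain ⟨x, hx, h⟩ := exists_gt_of_lt_gammaZero h0 hγ
  by_contra! h1
  have h2 := h 1 one_pos (by linarith)
  -- the binary entropy vanishes at `1`, while the objective is nonnegative
  have h3 : 0 ≤ Ftilde n t d₀ 1 := by
    refine Real.sSup_nonneg ?_
    rintro _ ⟨z, hz, rfl⟩
    rw [mem_region_iff] at hz
    rw [objective_eq, logObjective]
    refine div_nonneg (Finset.sum_nonneg fun i _ => add_nonneg ?_ ?_)
      (Real.log_nonneg one_le_two)
    · refine Real.negMulLog_nonneg (hz.1.1 i) ?_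
      rw [← hz.1.2]
      exact Finset.single_le_sum (fun j _ => hz.1.1 j) (Finset.mem_univ i)
    · exact mul_nonneg (hz.1.1 i) (Real.log_natCast_nonneg _)
  have h4 : 0 ≤ (l / n : ℝ) * Ftilde n t d₀ 1 := by positivity
  simp [binaryEntropy] at h2
  linarith

theorem exponent_neg_of_lt_gammaZero {l n t d₀ : ℕ} (htd : 2 * t + 1 ≤ d₀) (hdn : d₀ ≤ n)
    {γ : ℝ} (hγ : γ < gammaZero l n t d₀) {p : ℝ} (h0 : 0 < p) (hp : p ≤ γ)
    {z : Fin (n + 1) → ℝ} (hz : z ∈ stdSimplex ℝ (Fin (n + 1))) (hm : mean n z = p * n)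
    (hz0 : balance n t d₀ z ≤ 0) :
    (l / n : ℝ) * logObjective n z < (l - 1) * Real.binEntropy p := by
  have hγ0 := h0.trans_le hp
  have hγ1 := lt_one_of_lt_gammaZero hγ0 hγ
  have hp1 : p < 1 := hp.trans_lt hγ1
  obtain ⟨x, hx, h⟩ := exists_gt_of_lt_gammaZero hγ0 hγ
  have hne (q : ℝ) (hq0 : 0 < q) (hq : q ≤ γ) : balance n t d₀ (binomial n q) ≠ 0 :=
    balance_binomial_ne_zero (by omega) hq0 (hq.trans_lt hγ1) (h q hq0 (hq.trans hx.le))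
  have ht : 1 ≤ t := by
    by_contra! ht
    refine hne p h0 hp ?_
    obtain rfl : t = 0 := by omega
    simp [balance]
  refine logObjective_lt_of_balance_nonpos h0 hp1 (h p h0 (hp.trans hx.le)) ?_ hz hm hz0
  by_contra! hb
  obtain ⟨q, hq0, hqp, -, hq⟩ := exists_balance_binomial_pos ht htd hdn h0
  obtain ⟨r, hr, hr0⟩ := intermediate_value_Icc' hqp.le
    (continuous_balance_binomial n t d₀).continuousOn ⟨hb, hq.le⟩
  exact hne r (hq0.trans_le hr.1) (hr.2.trans hp) hr0

/-- The compactness argument that makes the bound uniform and leaves room for a slack in the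
balance. -/
theorem exists_uniform_exponent {l n t d₀ : ℕ} (htd : 2 * t + 1 ≤ d₀) (hdn : d₀ ≤ n)
    {β γ : ℝ} (hβ : 0 < β) (hγ : γ < gammaZero l n t d₀) :
    ∃ ε > 0, ∃ c > 0, ∀ z ∈ stdSimplex ℝ (Fin (n + 1)), β * n ≤ mean n z → mean n z ≤ γ * n →
      balance n t d₀ z < ε →
      (l / n : ℝ) * logObjective n z ≤ (l - 1) * Real.binEntropy (mean n z / n) - c := by
  have hn : (0 : ℝ) < n := by exact_mod_cast (by omega : 0 < n)
  set K : Set (Fin (n + 1) → ℝ) :=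
    stdSimplex ℝ (Fin (n + 1)) ∩ {z | β * n ≤ mean n z ∧ mean n z ≤ γ * n} with hK
  set φ : (Fin (n + 1) → ℝ) → ℝ := fun z =>
    (l - 1) * Real.binEntropy (mean n z / n) - (l / n : ℝ) * logObjective n z with hφ
  have hmc := continuous_mean n
  have hφc : Continuous φ := by
    have := continuous_logObjective n
    have := Real.binEntropy_continuous
    fun_prop
  have hKc : IsCompact K := (isCompact_stdSimplex ℝ _).inter_right
    ((isClosed_le continuous_const hmc).inter (isClosed_le hmc continuous_const))
  have hneg (z) (hz : z ∈ K) (hb : balance n t d₀ z ≤ 0) : 0 < φ z := by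
    obtain ⟨hz, h1, h2⟩ := hz
    rw [← le_div_iff₀ hn] at h1
    rw [← div_le_iff₀ hn] at h2
    exact sub_pos.2 (exponent_neg_of_lt_gammaZero htd hdn hγ (hβ.trans_le h1) h2 hz
      (div_mul_cancel₀ _ hn.ne').symm hb)
  -- where the exponent is not negative, the balance has a positive lower bound
  obtain ⟨ε, hε, hεK⟩ : ∃ ε > 0, ∀ z ∈ K, φ z ≤ 0 → ε ≤ balance n t d₀ z := by
    obtain ⟨ε, hε, h⟩ := (hKc.inter_right (isClosed_le hφc continuous_const)).exists_forall_le'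
      (continuous_balance n t d₀).continuousOn (a := 0)
      (fun z hz => lt_of_not_ge fun hb => (hneg z hz.1 hb).not_ge hz.2)
    exact ⟨ε, hε, fun z hz hz' => h z ⟨hz, hz'⟩⟩
  obtain ⟨c, hc, hcK⟩ := (hKc.inter_right
    (isClosed_le (continuous_balance n t d₀) (continuous_const (y := ε / 2)))).exists_forall_le'
      hφc.continuousOn (a := 0) (fun z hz => by
        by_contra! h
        have := hεK z hz.1 h
        have := hz.2
        simp only [Set.mem_ofPred_eq] at this
        linarith)
  refine ⟨ε / 2, by positivity, c, hc, fun z hz h1 h2 h3 => ?_⟩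
  have := hcK z ⟨⟨hz, h1, h2⟩, h3.le⟩
  simp only [hφ] at this
  linarith

/-! ### Counting error sets by their type -/

section Types

theorem sum_comp_eq_sum_card_mul {α β : Type*} [Fintype α] [Fintype β] [DecidableEq β]
    (g : α → β) (f : β → ℝ) :
    ∑ a, f (g a) = ∑ b, (Finset.card {a | g a = b} : ℝ) * f b := by
  rw [← Finset.sum_fiberwise (s := Finset.univ) (g := g)]
  refine Finset.sum_congr rfl fun b _ => ?_
  rw [← nsmul_eq_mul, ← Finset.sum_const]
  exact Finset.sum_congr rfl fun a ha => by rw [(Finset.mem_filter.1 ha).2]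

/-- The size of a subset of `Fin n`, as an element of `Fin (n + 1)`. -/
def cardFin {n : ℕ} (A : Finset (Fin n)) : Fin (n + 1) :=
  ⟨A.card, Nat.lt_succ_of_le (by simpa using A.card_le_univ)⟩

/-- The places of the vertex `v` that are occupied by the elements of `S`. -/
def slice {n m : ℕ} (S : Finset (Fin m × Fin n)) (v : Fin m) : Finset (Fin n) :=
  {s | (v, s) ∈ S}

/-- The number of vertices with exactly `k` places in `S`. -/
def typeCount {n m : ℕ} (S : Finset (Fin m × Fin n)) (k : Fin (n + 1)) : ℕ :=
  Finset.card {v | cardFin (slice S v) = k}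

/-- The type of `S`: the fractions of the vertices with `0, …, n` places in `S`. -/
def typeDist {n m : ℕ} (S : Finset (Fin m × Fin n)) (k : Fin (n + 1)) : ℝ := typeCount S k / m

variable {n m : ℕ}

theorem slice_bijective : Function.Bijective (slice : Finset (Fin m × Fin n) → _) := by
  constructor
  · intro S T h
    ext ⟨v, s⟩
    have := congrArg (s ∈ ·) (congrFun h v)
    simpa [slice] using this
  · intro f
    refine ⟨Finset.univ.filter fun e => e.2 ∈ f e.1, ?_⟩
    funext v
    ext s
    simp [slice]

theorem sum_typeCount_mul (S : Finset (Fin m × Fin n)) (f : Fin (n + 1) → ℝ) :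
    ∑ k, typeCount S k * f k = ∑ v, f (cardFin (slice S v)) :=
  (sum_comp_eq_sum_card_mul _ f).symm

theorem sum_typeCount (S : Finset (Fin m × Fin n)) : ∑ k, (typeCount S k : ℝ) = m := by
  simpa using sum_typeCount_mul S 1

theorem typeDist_mem_stdSimplex (hm : 0 < m) (S : Finset (Fin m × Fin n)) :
    typeDist S ∈ stdSimplex ℝ (Fin (n + 1)) := by
  refine ⟨fun k => by unfold typeDist; positivity, ?_⟩
  simp only [typeDist, ← Finset.sum_div]
  rw [sum_typeCount, div_self (by positivity)]

theorem card_eq_sum_slice (S : Finset (Fin m × Fin n)) : S.card = ∑ v, (slice S v).card := by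
  rw [Finset.card_eq_sum_card_fiberwise (f := Prod.fst) (t := Finset.univ) (by simp)]
  refine Finset.sum_congr rfl fun v _ => ?_
  symm
  refine Finset.card_bij (fun s _ => (v, s)) ?_ ?_ ?_
  · intro s hs
    simpa [slice] using hs
  · simp
  · rintro ⟨v', s⟩ h
    obtain ⟨h, rfl⟩ := Finset.mem_filter.1 h
    exact ⟨s, by simpa [slice] using h, rfl⟩

theorem mean_typeDist (S : Finset (Fin m × Fin n)) : mean n (typeDist S) = S.card / m := by
  have h := sum_typeCount_mul S fun k => ((k : ℕ) : ℝ)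
  rw [card_eq_sum_slice, Nat.cast_sum, mean]
  simp only [typeDist, mul_div_assoc', ← Finset.sum_div]
  congr 1
  rw [← show _ = ∑ v, ((slice S v).card : ℝ) from h]
  exact Finset.sum_congr rfl fun k _ => mul_comm _ _

theorem balance_typeDist (t d₀ : ℕ) (S : Finset (Fin m × Fin n)) :
    balance n t d₀ (typeDist S) =
      (∑ v, (if (slice S v).card ≤ t then ((slice S v).card : ℝ) else 0) -
        t * ∑ v, (if d₀ - t ≤ (slice S v).card then 1 else 0)) / m := by
  have h1 := sum_typeCount_mul S fun k => if (k : ℕ) ≤ t then ((k : ℕ) : ℝ) else 0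
  have h2 := sum_typeCount_mul S fun k => if d₀ - t ≤ (k : ℕ) then (t : ℝ) else 0
  rw [balance, sub_div, Finset.mul_sum]
  simp only [mul_ite, mul_one, mul_zero]
  congr 1
  · refine Eq.trans ?_ (congrArg (· / (m : ℝ)) h1)
    simp only [Finset.sum_div, typeDist]
    exact Finset.sum_congr rfl fun k _ => by split_ifs <;> ring
  · refine Eq.trans ?_ (congrArg (· / (m : ℝ)) h2)
    simp only [Finset.sum_div, typeDist]
    exact Finset.sum_congr rfl fun k _ => by split_ifs <;> ring

theorem sum_cardFin (q : Fin (n + 1) → ℝ) :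
    ∑ A : Finset (Fin n), q (cardFin A) = ∑ k : Fin (n + 1), n.choose k * q k := by
  rw [sum_comp_eq_sum_card_mul]
  refine Finset.sum_congr rfl fun k _ => ?_
  congr 2
  have : ({A | cardFin A = k} : Finset (Finset (Fin n))) = Finset.powersetCard k Finset.univ := by
    ext A
    simp [cardFin, Fin.ext_iff, Finset.mem_powersetCard]
  rw [this, Finset.card_powersetCard, Finset.card_univ, Fintype.card_fin]

/-- The number of sets of a given type is at most exponential in the objective at this type.
Let the slices of a random set be independent, each of size `k` with probability `zₖ` and uniform
given its size; then every set of type `z` has probability `exp (-m logObjective z)`. -/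
theorem card_type_class_le (hm : 0 < m) (S₀ : Finset (Fin m × Fin n)) :
    (Finset.card {S : Finset (Fin m × Fin n) | typeCount S = typeCount S₀} : ℝ) ≤
      Real.exp (m * logObjective n (typeDist S₀)) := by
  have hm' : (0 : ℝ) < m := by exact_mod_cast hm
  have hz := typeDist_mem_stdSimplex hm S₀
  have hC (k : Fin (n + 1)) : (0 : ℝ) < n.choose k := by
    exact_mod_cast Nat.choose_pos (by omega)
  set q : Fin (n + 1) → ℝ := fun k => typeDist S₀ k / n.choose k with hq
  have hq0 (k : Fin (n + 1)) : 0 ≤ q k := div_nonneg (hz.1 k) (hC k).le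
  have htotal : ∑ S : Finset (Fin m × Fin n), ∏ v, q (cardFin (slice S v)) = 1 := by
    rw [slice_bijective.sum_comp fun f => ∏ v, q (cardFin (f v)), ← Fintype.piFinset_univ,
      ← Finset.prod_univ_sum (fun _ => Finset.univ) fun _ A => q (cardFin A), sum_cardFin]
    simp only [hq, mul_div_cancel₀ _ (hC _).ne']
    rw [hz.2, Finset.prod_const_one]
  have hweight (S : Finset (Fin m × Fin n)) (hS : typeCount S = typeCount S₀) :
      ∏ v, q (cardFin (slice S v)) = Real.exp (-(m * logObjective n (typeDist S₀))) := by
    have h1 : ∏ v, q (cardFin (slice S v)) = ∏ k, q k ^ typeCount S₀ k := by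
      rw [← hS, ← Finset.prod_fiberwise (s := Finset.univ) (g := fun v => cardFin (slice S v))]
      refine Finset.prod_congr rfl fun k _ => ?_
      rw [typeCount, ← Finset.prod_const]
      exact Finset.prod_congr rfl fun v hv => by rw [(Finset.mem_filter.1 hv).2]
    rw [h1, logObjective, Finset.mul_sum, ← Finset.sum_neg_distrib, Real.exp_sum]
    refine Finset.prod_congr rfl fun k _ => ?_
    rcases Nat.eq_zero_or_pos (typeCount S₀ k) with h | h
    · simp [typeDist, h]
    · have hzk : 0 < typeDist S₀ k := by unfold typeDist; positivity
      rw [← Real.exp_log (pow_pos (div_pos hzk (hC k)) _), Real.log_pow,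
        Real.log_div hzk.ne' (hC k).ne', Real.negMulLog]
      congr 1
      have : (typeCount S₀ k : ℝ) = m * typeDist S₀ k := by
        rw [typeDist, mul_div_cancel₀ _ hm'.ne']
      rw [this]
      ring
  have hle : ∑ S ∈ ({S | typeCount S = typeCount S₀} : Finset (Finset (Fin m × Fin n))),
      ∏ v, q (cardFin (slice S v)) ≤ 1 := by
    rw [← htotal]
    exact Finset.sum_le_sum_of_subset_of_nonneg (Finset.filter_subset _ _)
      fun S _ _ => Finset.prod_nonneg fun v _ => hq0 _
  rw [Finset.sum_congr rfl fun S hS => hweight S (Finset.mem_filter.1 hS).2, Finset.sum_const,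
    nsmul_eq_mul, Real.exp_neg, ← div_eq_mul_inv, div_le_one (Real.exp_pos _)] at hle
  exact hle

/-- There are polynomially many types, so that a family of sets whose types have a bounded
objective is small. -/
theorem card_le_of_logObjective_le (hm : 0 < m) (F : Finset (Finset (Fin m × Fin n))) {K : ℝ}
    (hF : ∀ S ∈ F, m * logObjective n (typeDist S) ≤ K) :
    (F.card : ℝ) ≤ (m + 1) ^ (n + 1) * Real.exp K := by
  have himage : (F.image typeCount).card ≤ (m + 1) ^ (n + 1) := by
    have : F.image typeCount ⊆ Fintype.piFinset fun _ => Finset.range (m + 1) := by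
      intro f hf
      obtain ⟨S, -, rfl⟩ := Finset.mem_image.1 hf
      rw [Fintype.mem_piFinset]
      intro k
      rw [Finset.mem_range, Nat.lt_succ_iff]
      exact (Finset.card_le_univ _).trans_eq (Fintype.card_fin m)
    refine (Finset.card_le_card this).trans_eq ?_
    simp
  have hfiber : ∀ f ∈ F.image typeCount, (F.filter fun S => typeCount S = f).card ≤
      ⌊Real.exp K⌋₊ := by
    intro f hf
    obtain ⟨S, hS, rfl⟩ := Finset.mem_image.1 hf
    refine Nat.le_floor (le_trans ?_ ((card_type_class_le hm S).trans
      (Real.exp_le_exp.2 (hF S hS))))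
    exact_mod_cast Finset.card_le_card (Finset.filter_subset_filter _ (Finset.subset_univ F))
  have h := Finset.card_le_mul_card_image F _ hfiber
  calc (F.card : ℝ) ≤ ⌊Real.exp K⌋₊ * (F.image typeCount).card := by exact_mod_cast h
    _ ≤ Real.exp K * (m + 1) ^ (n + 1) := by
        refine mul_le_mul (Nat.floor_le (Real.exp_pos K).le) ?_ (by positivity)
          (Real.exp_pos K).le
        exact_mod_cast himage
    _ = _ := mul_comm _ _

end Types

/-! ### Binomial coefficients and random permutations -/

theorem factorial_mul_pow_le (w k : ℕ) : w.factorial * w ^ k ≤ k.factorial * w ^ w := by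
  rcases le_total w k with h | h
  · calc w.factorial * w ^ k = w.factorial * w ^ (k - w) * w ^ w := by
          rw [mul_assoc, ← pow_add, Nat.sub_add_cancel h]
      _ ≤ _ := Nat.mul_le_mul_right _ (Nat.factorial_mul_pow_sub_le_factorial h)
  · calc w.factorial * w ^ k ≤ k.factorial * w ^ (w - k) * w ^ k := by
          refine Nat.mul_le_mul_right _ ?_
          rw [← Nat.factorial_mul_descFactorial (Nat.sub_le w k), Nat.sub_sub_self h]
          exact Nat.mul_le_mul_left _ (Nat.descFactorial_le_pow w _)
      _ = _ := by rw [mul_assoc, ← pow_add, Nat.sub_add_cancel h]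

/-- The binomial distribution with mean `w` is maximal at `w`. -/
theorem choose_mul_pow_le {N w k : ℕ} (hw : w ≤ N) (hk : k ≤ N) :
    N.choose k * (w ^ k * (N - w) ^ (N - k)) ≤ N.choose w * (w ^ w * (N - w) ^ (N - w)) := by
  have h := Nat.mul_le_mul (factorial_mul_pow_le w k) (factorial_mul_pow_le (N - w) (N - k))
  have hpos : 0 < k.factorial * (N - k).factorial * (w.factorial * (N - w).factorial) := by
    positivity
  refine Nat.le_of_mul_le_mul_left ?_ hpos
  calc _ = N.choose k * k.factorial * (N - k).factorial *
        (w.factorial * w ^ k * ((N - w).factorial * (N - w) ^ (N - k))) := by ring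
    _ = N.choose w * w.factorial * (N - w).factorial *
        (w.factorial * w ^ k * ((N - w).factorial * (N - w) ^ (N - k))) := by
          rw [Nat.choose_mul_factorial_mul_factorial hk, Nat.choose_mul_factorial_mul_factorial hw]
    _ ≤ N.choose w * w.factorial * (N - w).factorial *
        (k.factorial * w ^ w * ((N - k).factorial * (N - w) ^ (N - w))) :=
          Nat.mul_le_mul_left _ h
    _ = _ := by ring

theorem exp_binEntropy_le {N w : ℕ} (h0 : 0 < w) (hw : w < N) :
    Real.exp (N * Real.binEntropy (w / N)) ≤ (N + 1) * N.choose w := by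
  have hN : (0 : ℝ) < N := by exact_mod_cast h0.trans hw
  have hw0 : (0 : ℝ) < w := by exact_mod_cast h0
  have hwN : (0 : ℝ) < N - w := sub_pos.2 (by exact_mod_cast hw)
  set p : ℝ := w / N with hp
  have hp0 : 0 < p := by positivity
  have h1p : 1 - p = (N - w) / N := by rw [hp]; field_simp
  have hp1 : 0 < 1 - p := by rw [h1p]; positivity
  have hterm (k : Fin (N + 1)) : binomial N p k ≤ N.choose w * (p ^ w * (1 - p) ^ (N - w)) := by
    have hk : (k : ℕ) ≤ N := by omega
    have hle : (N.choose k * (w ^ (k : ℕ) * (N - w) ^ (N - (k : ℕ))) : ℝ) ≤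
        N.choose w * (w ^ w * (N - w) ^ (N - w)) := by
      have := choose_mul_pow_le hw.le hk
      rw [← Nat.cast_sub hw.le]
      exact_mod_cast this
    have hexp (j : ℕ) (hj : j ≤ N) :
        p ^ j * (1 - p) ^ (N - j) = w ^ j * (N - w) ^ (N - j) / (N : ℝ) ^ N := by
      rw [h1p, hp, div_pow, div_pow, div_mul_div_comm, ← pow_add, Nat.add_sub_cancel' hj]
    rw [binomial, mul_assoc, hexp _ hk, hexp _ hw.le, ← mul_div_assoc, ← mul_div_assoc]
    exact div_le_div_of_nonneg_right hle (by positivity)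
  have hsum := Finset.sum_le_sum fun k (_ : k ∈ Finset.univ) => hterm k
  rw [sum_binomial, Finset.sum_const, Finset.card_univ, Fintype.card_fin, nsmul_eq_mul] at hsum
  have hexp : p ^ w * (1 - p) ^ (N - w) = Real.exp (-(N * Real.binEntropy p)) := by
    rw [← Real.exp_log (mul_pos (pow_pos hp0 w) (pow_pos hp1 (N - w))),
      Real.log_mul (by positivity) (by positivity), Real.log_pow, Real.log_pow,
      Nat.cast_sub hw.le, Real.binEntropy_eq_negMulLog_add_negMulLog_one_sub, Real.negMulLog,
      Real.negMulLog]
    have e1 : (w : ℝ) = N * p := by rw [hp]; field_simp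
    congr 1
    rw [e1]
    ring
  rw [hexp, Real.exp_neg, ← mul_assoc, ← div_eq_mul_inv, one_le_div (Real.exp_pos _)] at hsum
  exact_mod_cast hsum

open scoped Classical in
/-- The image of a set of size `w` under a random permutation is a uniformly random set of
size `w`. -/
theorem card_perm_map_mul_choose {α : Type*} [Fintype α] [DecidableEq α]
    (Q : Finset α → Prop) (S : Finset α) :
    Finset.card {π : Equiv.Perm α | Q (S.map π.toEmbedding)} * (Fintype.card α).choose S.card =
      (Fintype.card α).factorial * Finset.card {T : Finset α | T.card = S.card ∧ Q T} := by
  -- both sides count the pairs of a permutation and a set of size `S.card` with image in `Q`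
  have h1 (T : Finset α) (hT : T ∈ Finset.powersetCard S.card Finset.univ) :
      ∑ π : Equiv.Perm α, (if Q (T.map π.toEmbedding) then 1 else 0) =
        Finset.card {π : Equiv.Perm α | Q (S.map π.toEmbedding)} := by
    obtain ⟨σ, rfl⟩ := Equiv.Perm.exists_map_finset_eq S T (Finset.mem_powersetCard.1 hT).2.symm
    rw [Finset.card_filter]
    refine Fintype.sum_equiv (Equiv.mulRight σ) _ _ fun π => ?_
    rw [Finset.map_map]
    rfl
  have h2 (π : Equiv.Perm α) : ∑ T ∈ Finset.powersetCard S.card Finset.univ,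
      (if Q (T.map π.toEmbedding) then 1 else 0) =
        Finset.card {T : Finset α | T.card = S.card ∧ Q T} := by
    rw [← Finset.card_filter]
    refine Finset.card_bij (fun T _ => T.map π.toEmbedding) ?_ ?_ ?_
    · intro T hT
      simpa [Finset.mem_powersetCard] using hT
    · intro T _ T' _ h
      exact Finset.map_injective _ h
    · intro T hT
      have e : (T.map π.symm.toEmbedding).map π.toEmbedding = T := by
        ext a
        simp
      refine ⟨T.map π.symm.toEmbedding, ?_, e⟩
      rw [Finset.mem_filter, e, Finset.mem_powersetCard]
      simpa using hT
  have h3 := Finset.sum_comm (s := Finset.powersetCard S.card (Finset.univ : Finset α))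
    (t := (Finset.univ : Finset (Equiv.Perm α)))
    (f := fun T π => if Q (T.map π.toEmbedding) then 1 else 0)
  rw [Finset.sum_congr rfl h1, Finset.sum_congr rfl fun π _ => h2 π, Finset.sum_const,
    Finset.sum_const, Finset.card_powersetCard, Finset.card_univ, Finset.card_univ,
    Fintype.card_perm, smul_eq_mul, smul_eq_mul] at h3
  rw [mul_comm, h3]

/-! ### Decoding -/

section Decoding

theorem minDist_le_hammingDist {n d₀ : ℕ} {A : Submodule (ZMod 2) (Fin n → ZMod 2)}
    (hA : HasMinDist A d₀) {a b : Fin n → ZMod 2} (ha : a ∈ A) (hb : b ∈ A) (hab : a ≠ b) :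
    d₀ ≤ hammingDist a b := by
  refine hA.2 ⟨-a + b, A.add_mem (A.neg_mem ha) hb, ?_, (hammingDist_eq_hammingNorm a b).symm⟩
  rwa [Ne, neg_add_eq_zero]

variable {n t d₀ : ℕ} {A : Submodule (ZMod 2) (Fin n → ZMod 2)}

theorem localDecode_eq (hA : HasMinDist A d₀) (htd : 2 * t + 1 ≤ d₀) {a z : Fin n → ZMod 2}
    (ha : a ∈ A) (h : hammingDist z a ≤ t) : localDecode A t z = a := by
  have hu : ∃! a, a ∈ A ∧ hammingDist z a ≤ t := by
    refine ⟨a, ⟨ha, h⟩, fun b hb => ?_⟩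
    by_contra hne
    have h1 := minDist_le_hammingDist hA hb.1 ha hne
    have h2 := hammingDist_triangle b z a
    rw [hammingDist_comm b z] at h2
    have := hb.2
    omega
  rw [localDecode, dif_pos hu]
  exact hu.unique hu.choose_spec.1 ⟨ha, h⟩

theorem hammingDist_localDecode_le (z : Fin n → ZMod 2) :
    hammingDist (localDecode A t z) z ≤ t := by
  rw [localDecode]
  split_ifs with h
  · rw [hammingDist_comm]
    exact h.choose_spec.1.2
  · simp

theorem localDecode_eq_self (hA : HasMinDist A d₀) {a z : Fin n → ZMod 2}
    (ha : a ∈ A) (h1 : t < hammingDist z a) (h2 : hammingDist z a < d₀ - t) :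
    localDecode A t z = z := by
  rw [localDecode, dif_neg]
  rintro ⟨b, ⟨hb, hbt⟩, -⟩
  have hne : a ≠ b := by
    rintro rfl
    omega
  have h3 := minDist_le_hammingDist hA ha hb hne
  have h4 := hammingDist_triangle a z b
  rw [hammingDist_comm a z] at h4
  omega

/-- The effect of decoding on the errors at one vertex. -/
theorem hammingDist_localDecode_add_le (hA : HasMinDist A d₀) (htd : 2 * t + 1 ≤ d₀)
    {a : Fin n → ZMod 2} (ha : a ∈ A) (z : Fin n → ZMod 2) :
    hammingDist (localDecode A t z) a + (if hammingDist z a ≤ t then hammingDist z a else 0) ≤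
      hammingDist z a + (if d₀ - t ≤ hammingDist z a then t else 0) := by
  rcases le_or_gt (hammingDist z a) t with h1 | h1
  · rw [localDecode_eq hA htd ha h1, hammingDist_self, if_pos h1]
    omega
  rw [if_neg h1.not_ge]
  rcases lt_or_ge (hammingDist z a) (d₀ - t) with h2 | h2
  · rw [localDecode_eq_self hA ha h1 h2]
    omega
  · rw [if_pos h2]
    have := hammingDist_triangle (localDecode A t z) z a
    have := hammingDist_localDecode_le (A := A) (t := t) z
    omega

variable {l m : ℕ}

/-- The positions in which `u` and `x` differ. -/
def errorSet (u x : Edge n m → ZMod 2) : Finset (Edge n m) := {e | u e ≠ x e}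

theorem mem_errorSet {u x : Edge n m → ZMod 2} {e : Edge n m} : e ∈ errorSet u x ↔ u e ≠ x e := by
  rw [errorSet, Finset.mem_filter_univ]

theorem mem_edgesAt {H : Hypergraph l n m} {i : Fin l} {v : Fin m} {e : Edge n m} :
    e ∈ edgesAt H i v ↔ (place H i e).1 = v := by
  rw [edgesAt, Finset.mem_filter_univ, endpoint]

theorem mem_goodEdges {H : Hypergraph l n m} {i : Fin l} {err : Finset (Edge n m)} {e : Edge n m} :
    e ∈ goodEdges t H i err ↔
      e ∈ err ∧ (edgesAt H i (place H i e).1 ∩ err).card ≤ t := by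
  rw [goodEdges, Finset.mem_filter, goodVertices, Finset.mem_filter_univ, endpoint]

theorem card_errorSet (u x : Edge n m → ZMod 2) : (errorSet u x).card = hammingDist u x := rfl

theorem card_edgesAt_inter (H : Hypergraph l n m) (i : Fin l) (v : Fin m)
    (u x : Edge n m → ZMod 2) :
    (edgesAt H i v ∩ errorSet u x).card = hammingDist (localWord H i u v) (localWord H i x v) := by
  symm
  refine Finset.card_bij (fun s _ => (place H i).symm (v, s)) ?_ ?_ ?_
  · intro s hs
    rw [Finset.mem_filter_univ] at hs
    rw [Finset.mem_inter, mem_edgesAt, mem_errorSet, Equiv.apply_symm_apply]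
    exact ⟨rfl, hs⟩
  · intro s _ s' _ h
    simpa using h
  · intro e he
    rw [Finset.mem_inter, mem_edgesAt, mem_errorSet] at he
    have h : (place H i).symm (v, (place H i e).2) = e := by
      rw [Equiv.symm_apply_eq, ← he.1]
    refine ⟨(place H i e).2, ?_, h⟩
    rw [Finset.mem_filter_univ, localWord, localWord, h]
    exact he.2

theorem hammingDist_eq_sum (H : Hypergraph l n m) (i : Fin l) (u x : Edge n m → ZMod 2) :
    hammingDist u x = ∑ v, hammingDist (localWord H i u v) (localWord H i x v) := by
  simp only [← card_edgesAt_inter, ← card_errorSet]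
  rw [Finset.card_eq_sum_card_fiberwise (f := endpoint H i) (t := Finset.univ) (by simp)]
  refine Finset.sum_congr rfl fun v _ => congrArg Finset.card ?_
  ext e
  simp [edgesAt, and_comm]

theorem localWord_subprocedure (H : Hypergraph l n m) (i : Fin l) (u : Edge n m → ZMod 2)
    (v : Fin m) :
    localWord H i (subprocedure A t H i u) v = localDecode A t (localWord H i u v) := by
  funext s
  simp [localWord, subprocedure, endpoint]

theorem card_goodEdges (H : Hypergraph l n m) (i : Fin l) (err : Finset (Edge n m)) :
    (goodEdges t H i err).card =
      ∑ v, if (edgesAt H i v ∩ err).card ≤ t then (edgesAt H i v ∩ err).card else 0 := by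
  rw [Finset.card_eq_sum_card_fiberwise (f := endpoint H i) (t := Finset.univ) (by simp)]
  refine Finset.sum_congr rfl fun v _ => ?_
  split_ifs with h
  · congr 1
    ext e
    rw [Finset.mem_filter, mem_goodEdges, Finset.mem_inter, mem_edgesAt, endpoint]
    constructor
    · rintro ⟨⟨h1, -⟩, h2⟩
      exact ⟨h2, h1⟩
    · rintro ⟨rfl, h1⟩
      exact ⟨⟨h1, h⟩, rfl⟩
  · rw [Finset.card_eq_zero, Finset.filter_eq_empty_iff]
    rintro e he rfl
    exact h (mem_goodEdges.1 he).2

theorem card_badVertices (H : Hypergraph l n m) (i : Fin l) (err : Finset (Edge n m)) :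
    (badVertices t d₀ H i err).card =
      ∑ v, if d₀ - t ≤ (edgesAt H i v ∩ err).card then 1 else 0 := by
  rw [badVertices, Finset.card_filter]

/-- A subprocedure corrects the errors at the good vertices, adds at most `t` errors at each bad
one, and leaves the other vertices alone. -/
theorem hammingDist_subprocedure_add_le (hA : HasMinDist A d₀) (htd : 2 * t + 1 ≤ d₀)
    {H : Hypergraph l n m} {x : Edge n m → ZMod 2} (hx : x ∈ graphCode A H) (i : Fin l)
    (u : Edge n m → ZMod 2) :
    hammingDist (subprocedure A t H i u) x + (goodEdges t H i (errorSet u x)).card ≤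
      hammingDist u x + t * (badVertices t d₀ H i (errorSet u x)).card := by
  rw [card_goodEdges, card_badVertices, hammingDist_eq_sum H i, hammingDist_eq_sum H i u,
    Finset.mul_sum, ← Finset.sum_add_distrib, ← Finset.sum_add_distrib]
  refine Finset.sum_le_sum fun v _ => ?_
  rw [card_edgesAt_inter, localWord_subprocedure, mul_ite, mul_one, mul_zero]
  exact hammingDist_localDecode_add_le hA htd (hx i v) _

/-- If every error set of relative size between `β` and `γ` can be decreased in some part, then
`⌈γ / ε⌉` iterations suffice. -/
theorem exists_candidate (hA : HasMinDist A d₀) (htd : 2 * t + 1 ≤ d₀)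
    {H : Hypergraph l n m} {x y : Edge n m → ZMod 2} (hx : x ∈ graphCode A H) {β γ ε : ℝ}
    (hβ : 0 < β) (hε : 0 < ε)
    (hH : ∀ err : Finset (Edge n m), β * ((n : ℝ) * m) ≤ err.card →
      (err.card : ℝ) ≤ γ * ((n : ℝ) * m) → ∃ i : Fin l,
        (t : ℝ) * (badVertices t d₀ H i err).card + ε * ((n : ℝ) * m) ≤ (goodEdges t H i err).card)
    (hy : (hammingDist y x : ℝ) ≤ γ * ((n : ℝ) * m)) :
    ∃ j ≤ ⌈γ / ε⌉₊, ∃ z ∈ candidates A t H y j, (hammingDist z x : ℝ) ≤ β * ((n : ℝ) * m) := by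
  by_contra! hno
  have hN : (0 : ℝ) ≤ (n : ℝ) * m := by positivity
  have key (j : ℕ) (hj : j ≤ ⌈γ / ε⌉₊) : ∃ z ∈ candidates A t H y j,
      (hammingDist z x : ℝ) ≤ γ * ((n : ℝ) * m) - j * (ε * ((n : ℝ) * m)) := by
    induction j with
    | zero => exact ⟨y, rfl, by simpa using hy⟩
    | succ j ih =>
      obtain ⟨z, hz, hzx⟩ := ih (by omega)
      have h1 := hno j (by omega) z hz
      have h2 : 0 ≤ (j : ℝ) * (ε * ((n : ℝ) * m)) := by positivity
      obtain ⟨i, hi⟩ := hH (errorSet z x) (by rw [card_errorSet]; exact h1.le)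
        (by rw [card_errorSet]; linarith)
      refine ⟨subprocedure A t H i z, ⟨z, hz, i, rfl⟩, ?_⟩
      have h3 : (hammingDist (subprocedure A t H i z) x : ℝ) +
          (goodEdges t H i (errorSet z x)).card ≤
          hammingDist z x + t * (badVertices t d₀ H i (errorSet z x)).card := by
        exact_mod_cast hammingDist_subprocedure_add_le hA htd hx i z
      push_cast
      linarith
  obtain ⟨z, hz, hzx⟩ := key _ le_rfl
  have h1 := hno _ le_rfl z hz
  have h2 : γ ≤ ⌈γ / ε⌉₊ * ε := (div_le_iff₀ hε).1 (Nat.le_ceil _)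
  have h3 := mul_le_mul_of_nonneg_right h2 hN
  have h4 : 0 ≤ β * ((n : ℝ) * m) := by positivity
  linarith

end Decoding

/-! ### The union bound -/

theorem place_zero {l n m : ℕ} (H : Hypergraph l n m) {i : Fin l} (hi : (i : ℕ) = 0) :
    place H i = Equiv.refl _ := by
  rw [place, dif_pos hi]

theorem place_succ {l n m : ℕ} (H : Hypergraph l n m) (j : Fin (l - 1)) :
    place H ⟨j + 1, by omega⟩ = H j := by
  rw [place, dif_neg (by simp)]
  rfl

theorem ensembleProb_not {l n m : ℕ} (P : Hypergraph l n m → Prop) :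
    (ensembleProb l n m fun H => ¬P H) = 1 - ensembleProb l n m P := by
  classical
  have h : Nat.card {H // P H} + Nat.card {H // ¬P H} = Nat.card (Hypergraph l n m) := by
    rw [← Nat.card_sum, Nat.card_congr (Equiv.sumCompl P)]
  have h0 : (Nat.card (Hypergraph l n m) : ℝ) ≠ 0 := by exact_mod_cast Nat.card_pos.ne'
  rw [ensembleProb, ensembleProb, eq_sub_iff_add_eq', ← add_div, ← Nat.cast_add, h, div_self h0]

theorem ensembleProb_mono {l n m : ℕ} {P P' : Hypergraph l n m → Prop} (h : ∀ H, P H → P' H) :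
    ensembleProb l n m P ≤ ensembleProb l n m P' := by
  refine div_le_div_of_nonneg_right ?_ (Nat.cast_nonneg _)
  exact_mod_cast Nat.card_le_card_of_injective _ (Subtype.map_injective h Function.injective_id)

open scoped Classical in
/-- The expected number of sets of size `w` whose images in all `l` parts satisfy `Q` is
`B ^ l / C ^ (l - 1)` for the number `B` of sets of size `w` with `Q` and the number `C` of all
sets of size `w`: the first part contributes `B`, each of the others the probability `B / C`. -/
theorem ensembleProb_exists_le {l n m : ℕ} (hl : 2 ≤ l) (Q : Finset (Edge n m) → Prop)
    (W : Finset ℕ) {M : ℝ}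
    (hM : ∀ w ∈ W, (Finset.card {T : Finset (Edge n m) | T.card = w ∧ Q T} : ℝ) *
      ((Finset.card {T : Finset (Edge n m) | T.card = w ∧ Q T} : ℝ) /
        (Fintype.card (Edge n m)).choose w) ^ (l - 1) ≤ M) :
    (ensembleProb l n m fun H => ∃ err : Finset (Edge n m), err.card ∈ W ∧
      ∀ i : Fin l, Q (err.map (place H i).toEmbedding)) ≤ W.card * M := by
  set N := Fintype.card (Edge n m) with hN
  set B : ℕ → ℕ := fun w => Finset.card {T : Finset (Edge n m) | T.card = w ∧ Q T} with hB
  set E : Finset (Finset (Edge n m)) := {T | T.card ∈ W ∧ Q T} with hE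
  have hfac : (0 : ℝ) < N.factorial := by positivity
  have hcount : Nat.card {H : Hypergraph l n m // ∃ err : Finset (Edge n m), err.card ∈ W ∧
      ∀ i : Fin l, Q (err.map (place H i).toEmbedding)} ≤
      ∑ S ∈ E, (Finset.card {π : Equiv.Perm (Edge n m) | Q (S.map π.toEmbedding)}) ^ (l - 1) := by
    rw [Nat.card_eq_fintype_card, Fintype.card_subtype]
    refine (Finset.card_le_card (t := E.biUnion fun S => Fintype.piFinset fun _ =>
      {π : Equiv.Perm (Edge n m) | Q (S.map π.toEmbedding)}) ?_).trans
      (Finset.card_biUnion_le.trans_eq ?_)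
    · intro H hH
      obtain ⟨S, hS, hQ⟩ := (Finset.mem_filter.1 hH).2
      refine Finset.mem_biUnion.2 ⟨S, ?_, Fintype.mem_piFinset.2 fun j => ?_⟩
      · have := hQ ⟨0, by omega⟩
        rw [place_zero H rfl] at this
        refine Finset.mem_filter.2 ⟨Finset.mem_univ _, hS, ?_⟩
        simpa using this
      · have := hQ ⟨j + 1, by omega⟩
        rw [place_succ] at this
        exact Finset.mem_filter.2 ⟨Finset.mem_univ _, this⟩
    · exact Finset.sum_congr rfl fun S _ => by simp
  have hratio (S : Finset (Edge n m)) :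
      (Finset.card {π : Equiv.Perm (Edge n m) | Q (S.map π.toEmbedding)} : ℝ) / N.factorial =
        B S.card / N.choose S.card := by
    have hC : (0 : ℝ) < N.choose S.card := by
      exact_mod_cast Nat.choose_pos (Finset.card_le_univ S)
    rw [div_eq_div_iff hfac.ne' hC.ne', mul_comm (B S.card : ℝ)]
    exact_mod_cast card_perm_map_mul_choose Q S
  have htotal : (Nat.card (Hypergraph l n m) : ℝ) = (N.factorial : ℝ) ^ (l - 1) := by
    rw [Nat.card_eq_fintype_card, Fintype.card_fun, Fintype.card_perm, Fintype.card_fin]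
    push_cast
    rfl
  rw [ensembleProb, htotal]
  calc _ ≤ (∑ S ∈ E, (Finset.card {π : Equiv.Perm (Edge n m) | Q (S.map π.toEmbedding)} : ℝ) ^
        (l - 1)) / (N.factorial : ℝ) ^ (l - 1) := by
        refine div_le_div_of_nonneg_right ?_ (by positivity)
        exact_mod_cast hcount
    _ = ∑ S ∈ E, ((B S.card : ℝ) / N.choose S.card) ^ (l - 1) := by
        rw [Finset.sum_div]
        exact Finset.sum_congr rfl fun S _ => by rw [← div_pow, hratio]
    _ = ∑ w ∈ W, (B w : ℝ) * ((B w : ℝ) / N.choose w) ^ (l - 1) := by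
        rw [← Finset.sum_fiberwise_of_maps_to (s := E) (t := W) (g := Finset.card)
          fun S hS => (Finset.mem_filter.1 hS).2.1]
        refine Finset.sum_congr rfl fun w hw => ?_
        have hEw : E.filter (fun S => S.card = w) =
            ({T | T.card = w ∧ Q T} : Finset (Finset (Edge n m))) := by
          ext S
          simp only [hE, Finset.mem_filter, Finset.mem_univ, true_and]
          constructor
          · rintro ⟨⟨-, h⟩, rfl⟩
            exact ⟨rfl, h⟩
          · rintro ⟨rfl, h⟩
            exact ⟨⟨hw, h⟩, rfl⟩
        rw [hEw, Finset.sum_congr rfl fun S hS => by rw [(Finset.mem_filter.1 hS).2.1],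
          Finset.sum_const, nsmul_eq_mul]
    _ ≤ ∑ w ∈ W, M := Finset.sum_le_sum hM
    _ = W.card * M := by rw [Finset.sum_const, nsmul_eq_mul]

theorem card_slice_map_place {l n m : ℕ} (H : Hypergraph l n m) (i : Fin l)
    (err : Finset (Edge n m)) (v : Fin m) :
    (slice (err.map (place H i).toEmbedding) v).card = (edgesAt H i v ∩ err).card := by
  refine Finset.card_bij (fun s _ => (place H i).symm (v, s)) ?_ ?_ ?_
  · intro s hs
    rw [slice, Finset.mem_filter_univ, Finset.mem_map_equiv] at hs
    rw [Finset.mem_inter, mem_edgesAt, Equiv.apply_symm_apply]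
    exact ⟨rfl, hs⟩
  · intro s _ s' _ h
    simpa using h
  · intro e he
    rw [Finset.mem_inter, mem_edgesAt] at he
    have h : (place H i).symm (v, (place H i e).2) = e := by
      rw [Equiv.symm_apply_eq, ← he.1]
    refine ⟨(place H i e).2, ?_, h⟩
    rw [slice, Finset.mem_filter_univ, Finset.mem_map_equiv, h]
    exact he.2

/-- The balance of the type of the image of an error set in a part is the guaranteed decrease of
the number of errors per vertex. -/
theorem balance_typeDist_map_place {l n m : ℕ} (t d₀ : ℕ) (H : Hypergraph l n m) (i : Fin l)
    (err : Finset (Edge n m)) :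
    balance n t d₀ (typeDist (err.map (place H i).toEmbedding)) =
      ((goodEdges t H i err).card - t * (badVertices t d₀ H i err).card) / m := by
  rw [balance_typeDist, card_goodEdges, card_badVertices]
  simp only [card_slice_map_place]
  push_cast
  rfl

open scoped Classical in
/-- The summand of the union bound for sets of size `w`. -/
theorem card_mul_card_div_choose_pow_le {l n m : ℕ} (hl : 2 ≤ l) (hm : 0 < m) {w : ℕ}
    (h0 : 0 < w) (hw : w < m * n) {δ c : ℝ} {t d₀ : ℕ}
    (hz : ∀ z ∈ stdSimplex ℝ (Fin (n + 1)), mean n z = w / m → balance n t d₀ z < δ →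
      (l / n : ℝ) * logObjective n z ≤ (l - 1) * Real.binEntropy (mean n z / n) - c) :
    (Finset.card {T : Finset (Edge n m) | T.card = w ∧ balance n t d₀ (typeDist T) < δ} : ℝ) *
      ((Finset.card {T : Finset (Edge n m) | T.card = w ∧ balance n t d₀ (typeDist T) < δ} : ℝ) /
        (m * n).choose w) ^ (l - 1) ≤
      (m + 1) ^ ((n + 1) * l) * (m * n + 1) ^ (l - 1) * Real.exp (-(c * (m * n))) := by
  have hm' : (0 : ℝ) < m := by exact_mod_cast hm
  have hn : 0 < n := by
    by_contra! h
    simp_all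
  have hn' : (0 : ℝ) < n := by exact_mod_cast hn
  have hl' : (0 : ℝ) < l := by exact_mod_cast (by omega : 0 < l)
  have hC : (0 : ℝ) < (m * n).choose w := by exact_mod_cast Nat.choose_pos hw.le
  set h := Real.binEntropy ((w : ℝ) / (m * n : ℕ)) with hh
  set F : Finset (Finset (Edge n m)) := {T | T.card = w ∧ balance n t d₀ (typeDist T) < δ} with hF
  have hcard : (F.card : ℝ) ≤
      (m + 1) ^ (n + 1) * Real.exp (m * n / l * ((l - 1) * h - c)) := by
    refine card_le_of_logObjective_le hm F fun T hT => ?_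
    obtain ⟨rfl, hb⟩ := (Finset.mem_filter.1 hT).2
    have h1 := hz _ (typeDist_mem_stdSimplex hm T) (mean_typeDist T) hb
    rw [mean_typeDist, div_div, ← Nat.cast_mul] at h1
    have h2 := mul_le_mul_of_nonneg_left h1 (by positivity : (0 : ℝ) ≤ m * n / l)
    refine le_of_eq_of_le ?_ h2
    field_simp
  have hchoose := exp_binEntropy_le h0 hw
  rw [← hh] at hchoose
  push_cast at hchoose
  obtain ⟨k, rfl⟩ : ∃ k, l = k + 1 := ⟨l - 1, by omega⟩
  rw [Nat.add_sub_cancel, div_pow, ← mul_div_assoc, ← pow_succ', div_le_iff₀ (by positivity)]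
  calc (F.card : ℝ) ^ (k + 1)
      ≤ ((m + 1) ^ (n + 1) * Real.exp (m * n / (k + 1 : ℕ) * (((k + 1 : ℕ) - 1) * h - c))) ^
          (k + 1) := by gcongr
    _ = (m + 1) ^ ((n + 1) * (k + 1)) * Real.exp (-(c * (m * n))) *
          Real.exp (m * n * h) ^ k := by
        rw [mul_pow, ← pow_mul, ← Real.exp_nat_mul, ← Real.exp_nat_mul, mul_assoc,
          ← Real.exp_add]
        congr 2
        push_cast
        field_simp
        ring
    _ ≤ (m + 1) ^ ((n + 1) * (k + 1)) * Real.exp (-(c * (m * n))) *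
          ((m * n + 1) * (m * n).choose w) ^ k := by gcongr
    _ = _ := by rw [mul_pow]; ring

theorem eventually_polynomial_mul_exp_le {l n : ℕ} (hn : 0 < n) {c : ℝ} (hc : 0 < c) :
    ∀ᶠ m : ℕ in Filter.atTop,
      (m * n + 1 : ℝ) * ((m + 1) ^ ((n + 1) * l) * (m * n + 1) ^ (l - 1) *
        Real.exp (-(c * (m * n)))) ≤ Real.exp (-(c / 2 * (m * n))) := by
  have hn' : (1 : ℝ) ≤ n := by exact_mod_cast hn
  set r := Real.exp (-(c / 2 * n)) with hr
  have hr0 : 0 < r := Real.exp_pos _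
  have hr1 : r < 1 := Real.exp_lt_one_iff.2 (by nlinarith)
  have hlim := (tendsto_pow_const_mul_const_pow_of_abs_lt_one (1 + (n + 1) * l + (l - 1))
    (by rwa [abs_of_pos hr0] : |r| < 1)).comp (Filter.tendsto_add_atTop_nat 1)
  have hpos : 0 < r / (n : ℝ) ^ (1 + (l - 1)) := by positivity
  filter_upwards [hlim.eventually_lt_const hpos] with m hm
  simp only [Function.comp_apply, Nat.cast_add, Nat.cast_one] at hm
  rw [lt_div_iff₀ (by positivity), pow_succ r] at hm
  have hexp : Real.exp (-(c / 2 * (m * n))) = r ^ m := by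
    rw [hr, ← Real.exp_nat_mul]
    congr 1
    ring
  have hexp' : Real.exp (-(c * (m * n))) = r ^ m * r ^ m := by
    rw [← hexp, ← Real.exp_add]
    congr 1
    ring
  have hle : (m * n + 1 : ℝ) ≤ n * (m + 1) := by nlinarith
  rw [hexp, hexp']
  have hpoly : (m * n + 1 : ℝ) * ((m + 1) ^ ((n + 1) * l) * (m * n + 1) ^ (l - 1)) * r ^ m ≤
      1 := by
    calc _ ≤ (n * (m + 1) : ℝ) * ((m + 1) ^ ((n + 1) * l) * (n * (m + 1)) ^ (l - 1)) * r ^ m := by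
          gcongr
      _ = ((m + 1 : ℝ) ^ (1 + (n + 1) * l + (l - 1)) * r ^ m * (n : ℝ) ^ (1 + (l - 1))) := by
          rw [mul_pow]; ring
      _ ≤ 1 := by
          refine le_of_mul_le_mul_right ?_ hr0
          linarith
  calc _ = (m * n + 1 : ℝ) * ((m + 1) ^ ((n + 1) * l) * (m * n + 1) ^ (l - 1)) * r ^ m *
        r ^ m := by ring
    _ ≤ 1 * r ^ m := by gcongr
    _ = r ^ m := one_mul _

end HypergraphCodes

open HypergraphCodes in
theorem lemma2 (l n t d₀ : ℕ) (hl : 2 ≤ l) (htd : 2 * t + 1 ≤ d₀) (hdn : d₀ ≤ n)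
    (β γ : ℝ) (hβ : 0 < β) (hβγ : β < γ) (hγ : γ < HypergraphCodes.gammaZero l n t d₀) :
    ∃ ε : ℝ, 0 < ε ∧ ∃ s : ℕ, ∃ c : ℝ, 0 < c ∧ ∀ᶠ m : ℕ in Filter.atTop,
      1 - (2 : ℝ) ^ (-(c * ((n : ℝ) * m))) ≤
        HypergraphCodes.ensembleProb l n m (fun H =>
          (∀ err : Finset (HypergraphCodes.Edge n m),
            β * ((n : ℝ) * m) ≤ err.card → (err.card : ℝ) ≤ γ * ((n : ℝ) * m) →
            ∃ i : Fin l,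
              (t : ℝ) * (HypergraphCodes.badVertices t d₀ H i err).card + ε * ((n : ℝ) * m) ≤
                (HypergraphCodes.goodEdges t H i err).card) ∧
          (∀ A : Submodule (ZMod 2) (Fin n → ZMod 2), HypergraphCodes.HasMinDist A d₀ →
            ∀ x ∈ HypergraphCodes.graphCode A H, ∀ y : HypergraphCodes.Edge n m → ZMod 2,
              (hammingDist y x : ℝ) ≤ γ * ((n : ℝ) * m) →
              ∃ j ≤ s, ∃ z ∈ HypergraphCodes.candidates A t H y j,
                (hammingDist z x : ℝ) ≤ β * ((n : ℝ) * m))) := by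
  classical
  have hn : 0 < n := by omega
  have hn' : (0 : ℝ) < n := by exact_mod_cast hn
  have hγ1 := lt_one_of_lt_gammaZero (hβ.trans hβγ) hγ
  have hlog : 0 < Real.log 2 := Real.log_pos one_lt_two
  obtain ⟨δ, hδ, c, hc, hz⟩ := exists_uniform_exponent htd hdn hβ hγ
  refine ⟨δ / n, by positivity, ⌈γ / (δ / n)⌉₊, c / 2 / Real.log 2, by positivity, ?_⟩
  filter_upwards [eventually_polynomial_mul_exp_le (l := l) hn hc, Filter.eventually_gt_atTop 0]
    with m hpoly hm
  have hm' : (0 : ℝ) < m := by exact_mod_cast hm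
  have hcard : Fintype.card (Edge n m) = m * n := by simp
  set W : Finset ℕ := (Finset.range (m * n + 1)).filter fun w =>
    β * ((n : ℝ) * m) ≤ w ∧ (w : ℝ) ≤ γ * ((n : ℝ) * m) with hW
  have hprob := ensembleProb_exists_le (m := m) hl
    (fun T : Finset (Edge n m) => balance n t d₀ (typeDist T) < δ) W
    (M := (m + 1) ^ ((n + 1) * l) * (m * n + 1) ^ (l - 1) * Real.exp (-(c * (m * n)))) (by
      intro w hw
      obtain ⟨-, h1, h2⟩ := Finset.mem_filter.1 hw
      have h0 : 0 < w := by
        have : (0 : ℝ) < w := lt_of_lt_of_le (by positivity) h1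
        exact_mod_cast this
      have hwN : w < m * n := by
        have : (w : ℝ) < m * n := by
          refine h2.trans_lt ?_
          rw [mul_comm (m : ℝ)]
          exact mul_lt_of_lt_one_left (by positivity) hγ1
        exact_mod_cast this
      rw [hcard]
      refine card_mul_card_div_choose_pow_le hl hm h0 hwN fun z hzs hmean hb =>
        hz z hzs ?_ ?_ hb
      · rw [hmean, le_div_iff₀ hm']
        linarith
      · rw [hmean, div_le_iff₀ hm']
        linarith)
  have hWcard : (W.card : ℝ) ≤ m * n + 1 := by
    have : W.card ≤ m * n + 1 := (Finset.card_filter_le _ _).trans_eq (Finset.card_range _)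
    exact_mod_cast this
  have hsmall := hprob.trans ((mul_le_mul_of_nonneg_right hWcard (by positivity)).trans hpoly)
  have hexp : (2 : ℝ) ^ (-(c / 2 / Real.log 2 * ((n : ℝ) * m))) =
      Real.exp (-(c / 2 * (m * n))) := by
    rw [Real.rpow_def_of_pos two_pos]
    congr 1
    field_simp
  rw [hexp]
  refine (sub_le_sub_left hsmall 1).trans ?_
  rw [← ensembleProb_not]
  refine ensembleProb_mono fun H hH => ?_
  have hdec : ∀ err : Finset (Edge n m),
      β * ((n : ℝ) * m) ≤ err.card → (err.card : ℝ) ≤ γ * ((n : ℝ) * m) →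
      ∃ i : Fin l, (t : ℝ) * (badVertices t d₀ H i err).card + δ / n * ((n : ℝ) * m) ≤
        (goodEdges t H i err).card := by
    intro err h1 h2
    by_contra! hno
    refine hH ⟨err, ?_, fun i => ?_⟩
    · refine Finset.mem_filter.2 ⟨?_, h1, h2⟩
      rw [Finset.mem_range, Nat.lt_succ_iff, ← hcard]
      exact Finset.card_le_univ err
    · have := hno i
      rw [← mul_assoc, div_mul_cancel₀ _ hn'.ne'] at this
      rw [balance_typeDist_map_place, div_lt_iff₀ hm']
      linarith
  exact ⟨hdec, fun A hA x hx y hy =>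
    exists_candidate hA htd hx hβ (by positivity) hdec hy⟩

end
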